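/- Let $G$ be a finite game with perfect information, given by a finite rooted tree with set $Z$ of terminal nodes, a finite set $I$ of players, an assignment of a player to each non-terminal node, and payoff functions $f_j\colon Z\to\mathbb{R}$ ($j\in I$). For a node $n$ of player $j$ let $M_j(n)$ be the set of immediate successors of $n$ (the moves at $n$), and let $M_j$ be the union of the $M_j(n)$ over the nodes $n$ of $j$. A (behavioral) strategy of $j$ assigns to every node $n$ of $j$ a probability distribution on $M_j(n)$. In the infinitely repeated game, a super strategy $\Sigma_j$ of player $j$ assigns to every finite history $h\in Z^t$, $t\ge 0$, a strategy $\Sigma_j(h)$ of $j$ in $G$, which is played in round $t+1$; a profile $\Sigma=(\Sigma_j)_{j\in I}$ induces a probability distribution on the set $Z^\omega$ of infinite histories. Fix a player $i$ with $f_i(z)\in\{0,1\}$ for all $z\in Z$ ($1$ is a win, $0$ a loss), and suppose that $i$ has a strategy in $G$ that guarantees payoff $1$ whatever strategies the other players use. A valuation is a function $v\colon M_i\to\mathbb{R}$. The myopic strategy rule assigns to $v$ the strategy $\sigma^v$ for which, at each node $n$ of $i$, $\sigma^v(n)$ is the uniform distribution on the maximizers of $v$ over $M_i(n)$. The memoryless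 revision rule is defined as follows: for $z\in Z$ and $m\in M_i$, $v^z(m)=f_i(z)$ if $m$ lies on the path from the root to $z$, and $v^z(m)=v(m)$ otherwise; for the empty history $v^\Lambda=v$, and $v^{(z_1,\dots,z_t)}=\bigl(v^{(z_1,\dots,z_{t-1})}\bigr)^{z_t}$. Theorem. Let $v\ge 0$ be any nonnegative valuation of $i$, and let $\Sigma$ be any profile of super strategies such that $\Sigma_i(h)=\sigma^{v^h}$ for every finite history $h$. Then with probability $1$ (for the distribution on $Z^\omega$ induced by $\Sigma$) there is a round after which $i$ wins in every round. -/

import Mathlib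

open MeasureTheory ProbabilityTheory Filter

/-- A finite-tree game with perfect information: players `I`, nodes `V`. `Arc n m` means that `m`
is an immediate successor of `n`. The three axioms say that the arcs form a tree rooted at `root`.
A node without successors is terminal; the player who moves at a non-terminal node `n` is `turn n`
(the value of `turn` at terminal nodes is never used). -/
structure PerfectInfoGame (I V : Type*) where
  /-- the arcs of the tree -/
  Arc : V → V → Prop
  /-- the root of the tree -/
  root : V
  not_arc_root : ∀ n, ¬ Arc n root
  arc_unique : ∀ n n' m, Arc n m → Arc n' m → n = n'
  reachable : ∀ m, Relation.ReflTransGen Arc root m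
  /-- the player whose turn it is -/
  turn : V → I
  /-- the payoff functions, defined on the terminal nodes -/
  payoff : I → {z : V // ∀ m, ¬ Arc z m} → ℝ

namespace PerfectInfoGame

variable {I V : Type*} (G : PerfectInfoGame I V)

/-- The set `Z` of terminal nodes. -/
def Terminal : Type _ := {z : V // ∀ m, ¬ G.Arc z m}

/-- The set `M(n)` of moves available at the node `n`. -/
abbrev Move (n : V) : Type _ := {m : V // G.Arc n m}

/-- The set `N_i` of (non-terminal) nodes at which it is the turn of player `i`. -/
abbrev DecisionNode (i : I) : Type _ := {n : V // (∃ m, G.Arc n m) ∧ G.turn n = i}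

/-- The set `M_i` of all moves of player `i`. -/
abbrev PlayerMove (i : I) : Type _ := {m : V // ∃ n, G.turn n = i ∧ G.Arc n m}

instance [Finite V] : Finite G.Terminal := inferInstanceAs (Finite {z : V // ∀ m, ¬ G.Arc z m})

instance : MeasurableSpace G.Terminal := ⊤

instance : DiscreteMeasurableSpace G.Terminal := ⟨fun _ => trivial⟩

/-- `m` lies on the path from the root to the terminal node `z`. -/
def OnPath (m : V) (z : G.Terminal) : Prop := Relation.ReflTransGen G.Arc m z.1

/-- A behavioral strategy of player `i`. -/
abbrev Strategy (i : I) : Type _ := (n : G.DecisionNode i) → PMF (G.Move n.1)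

/-- A profile of behavioral strategies. -/
abbrev Profile : Type _ := (j : I) → G.Strategy j

theorem not_transGen_self (v : V) : ¬ Relation.TransGen G.Arc v v := by
  induction G.reachable v with
  | refl =>
    intro h
    obtain ⟨c, _, hc⟩ := Relation.TransGen.tail'_iff.1 h
    exact G.not_arc_root c hc
  | @tail a b _ hab ih =>
    intro h
    obtain ⟨c, hbc, hc⟩ := Relation.TransGen.tail'_iff.1 h
    obtain rfl := G.arc_unique _ _ _ hab hc
    exact ih (Relation.TransGen.head' hab hbc)

theorem wellFounded_flip_arc [Finite V] : WellFounded (fun m n => G.Arc n m) := by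
  let r : V → V → Prop := fun m n => Relation.TransGen G.Arc n m
  have : IsTrans V r := ⟨fun _ _ _ h h' => Relation.TransGen.trans h' h⟩
  have : Std.Irrefl r := ⟨fun v => G.not_transGen_self v⟩
  exact Subrelation.wf (fun h => Relation.TransGen.single h)
    (Finite.wellFounded_of_trans_of_irrefl r)

open Classical in
/-- The distribution of the terminal node that is reached when the play starts at a given node and
each player `j` follows `σ j`: at a terminal node the play ends; at any other node a move is drawn
from the strategy of the player whose turn it is, and the play continues from there. -/
noncomputable def playFrom [Finite V] (σ : G.Profile) : V → PMF G.Terminal :=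
  G.wellFounded_flip_arc.fix fun n rec =>
    if h : ∃ m, G.Arc n m then
      (σ (G.turn n) ⟨n, h, rfl⟩).bind fun m => rec m.1 m.2
    else
      PMF.pure ⟨n, not_exists.1 h⟩

/-- The distribution on terminal nodes induced by a strategy profile in the game. -/
noncomputable def play [Finite V] (σ : G.Profile) : PMF G.Terminal := G.playFrom σ G.root

/-- The payoffs of player `i` are `1` (win) and `0` (lose). -/
def IsWinLose (i : I) : Prop := ∀ z : G.Terminal, G.payoff i z = 0 ∨ G.payoff i z = 1

/-- Player `i` has a strategy that guarantees a win, whatever strategies the others use. -/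
def CanGuaranteeWin [Finite V] (i : I) : Prop :=
  ∃ s : G.Strategy i, ∀ σ : G.Profile, σ i = s →
    ∀ z : G.Terminal, G.play σ z ≠ 0 → G.payoff i z = 1

/-! ### The repeated game -/

/-- A super strategy of player `i`: a strategy for the next round, given the finite history (the
list, in chronological order, of the terminal nodes reached so far). -/
abbrev SuperStrategy (i : I) : Type _ := List G.Terminal → G.Strategy i

/-- A profile of super strategies. -/
abbrev SuperProfile : Type _ := (j : I) → G.SuperStrategy j

/-- The distribution of the terminal node reached in the next round after the finite history `h`. -/
noncomputable def nextRound [Finite V] (S : G.SuperProfile) (h : List G.Terminal) :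
    PMF G.Terminal :=
  G.play fun j => S j h

/-- The transition kernel from the results of the rounds `0, …, n` to the result of round
`n + 1`. -/
noncomputable def roundKernel [Finite V] (S : G.SuperProfile) (n : ℕ) :
    Kernel (Finset.Iic n → G.Terminal) G.Terminal :=
  Kernel.ofFunOfCountable fun x =>
    (G.nextRound S (List.ofFn fun k : Fin (n + 1) =>
      x ⟨k.1, Finset.mem_Iic.2 (Nat.le_of_lt_succ k.2)⟩)).toMeasure

instance [Finite V] (S : G.SuperProfile) (n : ℕ) : IsMarkovKernel (G.roundKernel S n) :=
  ⟨fun _ => PMF.toMeasure.isProbabilityMeasure _⟩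

/-- The probability distribution on infinite histories induced by a profile of super strategies
(Ionescu-Tulcea): round `0` is distributed according to the strategies played after the empty
history, and the later rounds follow the transition kernels. -/
noncomputable def historyMeasure [Finite V] (S : G.SuperProfile) : Measure (ℕ → G.Terminal) :=
  Kernel.trajMeasure (X := fun _ => G.Terminal) (G.nextRound S []).toMeasure (G.roundKernel S)

/-! ### Playing by valuation -/

/-- A valuation for player `i`. -/
abbrev Valuation (i : I) : Type _ := G.PlayerMove i → ℝ

/-- A strategy rule for player `i`. -/
abbrev StrategyRule (i : I) : Type _ := G.Valuation i → G.Strategy i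

/-- A revision rule for player `i`. -/
structure RevisionRule (i : I) where
  /-- the valuation after a finite history, given the initial valuation -/
  revise : G.Valuation i → List G.Terminal → G.Valuation i
  revise_nil : ∀ v, revise v [] = v

/-- The valuation super strategy induced by a strategy rule, a revision rule and an initial
valuation. -/
def valuationSuperStrategy {i : I} (s : G.StrategyRule i) (ρ : G.RevisionRule i)
    (v : G.Valuation i) : G.SuperStrategy i :=
  fun h => s (ρ.revise v h)

/-- A move available at a decision node of player `i`, as a move of player `i`. -/
def toPlayerMove {i : I} (n : G.DecisionNode i) (m : G.Move n.1) : G.PlayerMove i :=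
  ⟨m.1, n.1, n.2.2, m.2⟩

/-- The maximizers of `v` among the moves available at `n`. -/
def maximizers {i : I} (v : G.Valuation i) (n : G.DecisionNode i) : Set (G.Move n.1) :=
  {m | ∀ m', v (G.toPlayerMove n m') ≤ v (G.toPlayerMove n m)}

theorem maximizers_nonempty [Finite V] {i : I} (v : G.Valuation i) (n : G.DecisionNode i) :
    (G.maximizers v n).Nonempty := by
  obtain ⟨m, hm⟩ := n.2.1
  have : Nonempty (G.Move n.1) := ⟨⟨m, hm⟩⟩
  exact Finite.exists_max fun m => v (G.toPlayerMove n m)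

/-- The myopic strategy rule: the uniform distribution over the maximizers of the valuation. -/
noncomputable def myopic [Finite V] (i : I) : G.StrategyRule i := fun v n =>
  PMF.uniformOfFinset (Set.toFinite (G.maximizers v n)).toFinset
    ((Set.toFinite (G.maximizers v n)).toFinset_nonempty.2 (G.maximizers_nonempty v n))

open Classical in
/-- The memoryless revision after a single round with result `z`. -/
noncomputable def memorylessStep {i : I} (v : G.Valuation i) (z : G.Terminal) : G.Valuation i :=
  fun m => if G.OnPath m.1 z then G.payoff i z else v m

/-- The memoryless revision rule: the valuation is revised round by round. -/
noncomputable def memoryless (i : I) : G.RevisionRule i where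
  revise v h := h.foldl G.memorylessStep v
  revise_nil _ := rfl

end PerfectInfoGame

/-! Complete a guaranteeing strategy of `i` by uniform play of the others, and call a node winning
if `i` wins surely from it. Backward induction shows that almost surely only finitely many losses
pass through a winning node (`eventually_win_of_winsFrom`). At an opponent's node every successor is
winning. At a node of `i` some move `m'` is winning. If some move `m` there led to infinitely many
losses, it would be chosen infinitely often at value 0. Choices are myopic and values nonnegative,
so at these times all moves, `m'` included, tie at 0. Tied moves are equally likely, so `m'` is made
infinitely often; by induction it eventually leads only to wins, and its value stays 1, a
contradiction. The only probabilistic inputs are that realised moves maximize the current valuation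
(via `ae_nextRound_ne_zero`) and that a move infinitely often optimal at a reached node is made
infinitely often (`ae_frequently_onPath_move`), a conditional Borel-Cantelli argument. The rest is
deterministic along one history. -/

/-! ### Conditional Borel-Cantelli for Markov kernels on histories. -/

theorem condExp_le_of_forall_setIntegral_le {Ω : Type*} {m m₀ : MeasurableSpace Ω}
    {μ : Measure Ω} [IsFiniteMeasure μ] (hm : m ≤ m₀) {f g : Ω → ℝ}
    (hf : Integrable f μ) (hg : Integrable g μ)
    (h : ∀ E, MeasurableSet[m] E → ∫ x in E, f x ∂μ ≤ ∫ x in E, g x ∂μ) :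
    μ[f | m] ≤ᵐ[μ] μ[g | m] := by
  -- Over the trimmed measure only `m`-measurable test sets occur, and on these conditional
  -- expectations integrate like `f` and `g`.
  refine ae_le_of_ae_le_trim (hm := hm) ?_
  refine ae_le_of_forall_setIntegral_le (integrable_condExp.trim hm stronglyMeasurable_condExp)
    (integrable_condExp.trim hm stronglyMeasurable_condExp) fun E hE _ => ?_
  rw [← setIntegral_trim hm stronglyMeasurable_condExp hE,
    ← setIntegral_trim hm stronglyMeasurable_condExp hE, setIntegral_condExp hm hf hE,
    setIntegral_condExp hm hg hE]
  exact h E hE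

namespace ProbabilityTheory.Kernel

open Finset Preorder

variable {Z : Type*} [Countable Z] [MeasurableSpace Z] [DiscreteMeasurableSpace Z]

/-- A conditional Borel-Cantelli lemma: if, after the histories in `Q`, the set `C` is at most `K`
times as likely as the set `C'` in the next round, and `C` is reached infinitely often after such
histories, then so is `C'`. -/
theorem ae_frequently_of_kernel_le (μ₀ : Measure Z) [IsProbabilityMeasure μ₀]
    (κ : (n : ℕ) → Kernel (Iic n → Z) Z) [∀ n, IsMarkovKernel (κ n)]
    (Q : (n : ℕ) → Set (Iic n → Z)) (C C' : Set Z) (K : NNReal)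
    (hK : 0 < K)
    (h : ∀ n, ∀ x ∈ Q n, κ n x C ≤ K * κ n x C') :
    ∀ᵐ ω ∂(trajMeasure (X := fun _ => Z) μ₀ κ),
      (∃ᶠ n in atTop, frestrictLe (π := fun _ => Z) n ω ∈ Q n ∧ (ω (n + 1) : Z) ∈ C) →
        ∃ᶠ n in atTop, (ω n : Z) ∈ C' := by
  set μ : Measure (ℕ → Z) := trajMeasure (X := fun _ => Z) μ₀ κ with hμ
  let ℱ := Filtration.piLE (X := fun _ : ℕ => Z)
  let r : (n : ℕ) → (ℕ → Z) → (Iic n → Z) := fun n => frestrictLe (π := fun _ => Z) n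
  have hr : ∀ n, Measurable (r n) := fun n => measurable_frestrictLe n
  -- Indexed by the round in which `D` is hit, so that `s D` is adapted; the value at 0 does not
  -- affect the limsup.
  let s : Set Z → ℕ → Set (ℕ → Z) := fun D n => match n with
    | 0 => ∅
    | n + 1 => {ω | r n ω ∈ Q n ∧ ω (n + 1) ∈ D}
  have hs : ∀ D n, MeasurableSet[ℱ n] (s D n) := by
    intro D n
    cases n with
    | zero => exact @MeasurableSet.empty _ (ℱ 0)
    | succ n =>
      rw [Filtration.piLE_eq_comap_frestrictLe]
      exact ⟨{x | frestrictLe₂ (π := fun _ => Z) (Nat.le_succ n) x ∈ Q n ∧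
        x ⟨n + 1, by simp⟩ ∈ D}, .of_discrete, rfl⟩
  have hμs : ∀ D n (E : Set (Iic n → Z)), μ (r n ⁻¹' E ∩ s D (n + 1)) =
        ∫⁻ x in (E ∩ Q n), κ n x D ∂(μ.map (r n)) := by
    intro D n E
    rw [← Measure.compProd_apply_prod .of_discrete .of_discrete, hμ,
      map_frestrictLe_trajMeasure_compProd_eq_map_trajMeasure,
      Measure.map_apply ((hr n).prodMk (measurable_pi_apply _))
        ((MeasurableSet.of_discrete).prod .of_discrete)]
    congr 1
    ext ω
    exact and_assoc.symm
  have hcond : ∀ n, μ[(s C (n + 1)).indicator (1 : (ℕ → Z) → ℝ) | ℱ n] ≤ᵐ[μ]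
      (K : ℝ) • μ[(s C' (n + 1)).indicator (1 : (ℕ → Z) → ℝ) | ℱ n] := by
    intro n
    have hm := fun D => ℱ.le _ _ (hs D (n + 1))
    have hi := fun D => (integrable_const (1 : ℝ)).indicator (μ := μ) (hm D)
    refine (condExp_le_of_forall_setIntegral_le (ℱ.le n) (hi C) ((hi C').smul (K : ℝ))
      fun E hE => ?_).trans (condExp_smul (K : ℝ) _ _).le
    have e : ∀ D, ∫ x in E, (s D (n + 1)).indicator (fun _ => (1 : ℝ)) x ∂μ =
        (μ (E ∩ s D (n + 1))).toReal := by
      intro D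
      rw [setIntegral_indicator (hm D)]
      simp [Measure.real]
    simp only [Pi.smul_apply]
    rw [integral_smul, e, e, smul_eq_mul, ← ENNReal.coe_toReal, ← ENNReal.toReal_mul]
    refine ENNReal.toReal_mono (by finiteness) ?_
    rw [Filtration.piLE_eq_comap_frestrictLe] at hE
    obtain ⟨E, -, rfl⟩ := hE
    refine (hμs C n E).trans_le (le_of_le_of_eq ?_ (congrArg (_ * ·) (hμs C' n E).symm))
    rw [← lintegral_const_mul _ .of_discrete]
    exact setLIntegral_mono' .of_discrete fun x hx => h n x hx.2
  -- Lévy: an adapted sequence of events occurs infinitely often iff its conditional probabilities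
  -- have divergent sum. By `hcond`, divergence for `C` forces it for `C'`.
  filter_upwards [ae_mem_limsup_atTop_iff μ (hs C), ae_mem_limsup_atTop_iff μ (hs C'),
    ae_all_iff.2 hcond] with ω h₁ h₂ h₃ hC
  rw [mem_limsup_iff_frequently_mem] at h₁ h₂
  have hC₁ : ∃ᶠ n in atTop, ω ∈ s C n := (tendsto_add_atTop_nat 1).frequently hC
  refine (h₂.2 ?_).mono fun n hn => ?_
  · refine Tendsto.atTop_of_const_mul₀ (NNReal.coe_pos.2 hK)
      (tendsto_atTop_mono (fun n => ?_) (h₁.1 hC₁))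
    rw [Finset.mul_sum]
    exact Finset.sum_le_sum fun k _ => h₃ k
  · cases n with
    | zero => exact hn.elim
    | succ n => exact hn.2

end ProbabilityTheory.Kernel

/-! ### Reaching probabilities within a single round. -/

namespace PerfectInfoGame

variable {I V : Type*} {G : PerfectInfoGame I V}

/-- Parents are unique, so the ancestors of `z` form a chain; distinct comparable siblings would put
a cycle through `n`. -/
theorem eq_of_arc_of_reachable {n m m' z : V} (hm : G.Arc n m) (hm' : G.Arc n m')
    (h : Relation.ReflTransGen G.Arc m z) (h' : Relation.ReflTransGen G.Arc m' z) : m = m' := by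
  have key : ∀ {a b : V}, G.Arc n a → G.Arc n b → Relation.ReflTransGen G.Arc a b → a = b := by
    intro a b ha hb hab
    rcases hab.cases_tail with rfl | ⟨c, hac, hcb⟩
    · rfl
    · obtain rfl := G.arc_unique _ _ _ hb hcb
      exact (G.not_transGen_self n (Relation.TransGen.head' ha hac)).elim
  have U : Relator.RightUnique (Function.swap G.Arc) := fun a b c hb hc => G.arc_unique _ _ _ hb hc
  rcases Relation.ReflTransGen.total_of_right_unique U (Relation.ReflTransGen.swap _ _ h)
    (Relation.ReflTransGen.swap _ _ h') with h1 | h1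
  · exact (key hm' hm (Relation.reflTransGen_swap.1 h1)).symm
  · exact key hm hm' (Relation.reflTransGen_swap.1 h1)

variable [Finite V]

theorem playFrom_of_arc (σ : G.Profile) {a : V} (h : ∃ m, G.Arc a m) :
    G.playFrom σ a = (σ (G.turn a) ⟨a, h, rfl⟩).bind fun m => G.playFrom σ m.1 := by
  rw [playFrom, WellFounded.fix_eq, dif_pos h]

theorem playFrom_of_terminal (σ : G.Profile) {a : V} (h : ∀ m, ¬ G.Arc a m) :
    G.playFrom σ a = PMF.pure ⟨a, h⟩ := by
  rw [playFrom, WellFounded.fix_eq, dif_neg (not_exists.2 h)]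

theorem onPath_of_playFrom_ne_zero (σ : G.Profile) (a : V) (z : G.Terminal)
    (hz : G.playFrom σ a z ≠ 0) : G.OnPath a z := by
  induction a using G.wellFounded_flip_arc.induction with
  | _ a ih =>
    by_cases h : ∃ m, G.Arc a m
    · rw [playFrom_of_arc σ h, ← PMF.mem_support_iff, PMF.mem_support_bind_iff] at hz
      obtain ⟨c, -, hc⟩ := hz
      exact Relation.ReflTransGen.head c.2 (ih c.1 c.2 hc)
    · rw [playFrom_of_terminal σ (not_exists.1 h), ← PMF.mem_support_iff] at hz
      obtain rfl := (PMF.mem_support_pure_iff _ _).1 hz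
      exact Relation.ReflTransGen.refl

theorem toMeasure_playFrom_eq_zero (σ : G.Profile) {a m : V}
    (h : ∀ z, G.OnPath a z → ¬ G.OnPath m z) :
    (G.playFrom σ a).toMeasure {z | G.OnPath m z} = 0 := by
  rw [PMF.toMeasure_apply_eq_zero_iff _ (.of_discrete), Set.disjoint_left]
  exact fun z hz => h z (onPath_of_playFrom_ne_zero σ a z hz)

theorem toMeasure_playFrom_self (σ : G.Profile) (a : V) :
    (G.playFrom σ a).toMeasure {z | G.OnPath a z} = 1 := by
  rw [PMF.toMeasure_apply_eq_one_iff _ (.of_discrete)]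
  exact fun z hz => onPath_of_playFrom_ne_zero σ a z hz

/-- The probability of reaching a move of `n` is the probability of reaching `n` times the
probability that the strategy used at `n` gives to the move. -/
theorem toMeasure_playFrom_move (σ : G.Profile) {n : V} (hn : ∃ m, G.Arc n m) (m : G.Move n)
    (a : V) (ha : ¬ Relation.TransGen G.Arc n a) :
    (G.playFrom σ a).toMeasure {z | G.OnPath m.1 z} =
      σ (G.turn n) ⟨n, hn, rfl⟩ m * (G.playFrom σ a).toMeasure {z | G.OnPath n z} := by
  induction a using G.wellFounded_flip_arc.induction with
  | _ a ih =>
    by_cases han : a = n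
    · subst han
      rw [toMeasure_playFrom_self, mul_one, playFrom_of_arc σ hn,
        PMF.toMeasure_bind_apply _ _ _ (.of_discrete), tsum_eq_single m]
      · rw [toMeasure_playFrom_self, mul_one]
      · intro c hc
        rw [toMeasure_playFrom_eq_zero, mul_zero]
        exact fun z hz hz' => hc (Subtype.ext (eq_of_arc_of_reachable c.2 m.2 hz hz'))
    · by_cases h : ∃ m, G.Arc a m
      · simp only [playFrom_of_arc σ h, PMF.toMeasure_bind_apply _ _ _ MeasurableSet.of_discrete]
        rw [← ENNReal.tsum_mul_left]
        refine tsum_congr fun c => ?_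
        rw [ih c.1 c.2, mul_left_comm]
        -- If the child `c` were strictly below `n`, its only parent `a` would be `n` or strictly
        -- below it.
        intro hc
        obtain ⟨b, hb, hbc⟩ := Relation.TransGen.tail'_iff.1 hc
        obtain rfl := G.arc_unique _ _ _ c.2 hbc
        rcases Relation.reflTransGen_iff_eq_or_transGen.1 hb with rfl | hb
        exacts [han rfl, ha hb]
      -- The play ends at `a`, which is neither `n` nor below it, so both sides vanish.
      · have key : ¬ Relation.ReflTransGen G.Arc n a := fun hna => by
          rcases Relation.reflTransGen_iff_eq_or_transGen.1 hna with rfl | hna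
          exacts [han rfl, ha hna]
        have hz : ∀ z, G.OnPath a z → z.1 = a := fun z hz => by
          rcases hz.cases_head with h1 | ⟨c, hc, -⟩
          exacts [h1.symm, (h ⟨c, hc⟩).elim]
        rw [toMeasure_playFrom_eq_zero, toMeasure_playFrom_eq_zero, mul_zero]
        · exact fun z h1 h2 => key (hz z h1 ▸ h2)
        · exact fun z h1 h2 => key (Relation.ReflTransGen.head m.2 (hz z h1 ▸ h2))

theorem toMeasure_play_move (σ : G.Profile) {j : I} (n : G.DecisionNode j) (m : G.Move n.1) :
    (G.play σ).toMeasure {z | G.OnPath m.1 z} =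
      σ j n m * (G.play σ).toMeasure {z | G.OnPath n.1 z} := by
  obtain ⟨n, hn, rfl⟩ := n
  refine toMeasure_playFrom_move σ hn m G.root fun h => ?_
  obtain ⟨c, -, hc⟩ := Relation.TransGen.tail'_iff.1 h
  exact G.not_arc_root c hc

theorem apply_ne_zero_of_play_ne_zero (σ : G.Profile) {j : I} (n : G.DecisionNode j)
    (m : G.Move n.1) {z : G.Terminal} (hz : G.play σ z ≠ 0) (hm : G.OnPath m.1 z) :
    σ j n m ≠ 0 := by
  intro h0
  have h := toMeasure_play_move σ n m
  rw [h0, zero_mul, PMF.toMeasure_apply_eq_zero_iff _ (.of_discrete)] at h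
  exact Set.disjoint_left.1 h hz hm

theorem mem_support_myopic_iff {i : I} (v : G.Valuation i) (n : G.DecisionNode i)
    (m : G.Move n.1) : G.myopic i v n m ≠ 0 ↔ m ∈ G.maximizers v n := by
  rw [← PMF.mem_support_iff, myopic, PMF.mem_support_uniformOfFinset_iff, Set.Finite.mem_toFinset]

/-- The bound does not depend on `v`, so it supplies one Borel-Cantelli constant for all histories.
-/
theorem inv_card_le_myopic {i : I} (v : G.Valuation i) (n : G.DecisionNode i)
    (m : G.Move n.1) (hm : m ∈ G.maximizers v n) :
    (Nat.card (G.Move n.1) : ENNReal)⁻¹ ≤ G.myopic i v n m := by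
  rw [myopic, PMF.uniformOfFinset_apply_of_mem _ ((Set.Finite.mem_toFinset _).2 hm)]
  refine ENNReal.inv_le_inv.2 (Nat.cast_le.2 ?_)
  rw [← Set.ncard_eq_toFinset_card _ _]
  exact (Set.ncard_le_card _)

end PerfectInfoGame

/-! ### Evolution of the valuation along a fixed infinite history. -/

namespace PerfectInfoGame

variable {I V : Type*} {G : PerfectInfoGame I V}

/-- The results of the rounds before round `t`. -/
def history (ω : ℕ → G.Terminal) (t : ℕ) : List G.Terminal := List.ofFn fun k : Fin t => ω k

theorem history_succ (ω : ℕ → G.Terminal) (t : ℕ) : history ω (t + 1) = history ω t ++ [ω t] := by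
  rw [history, List.ofFn_succ', List.concat_eq_append]
  rfl

/-- The valuation held in round `t` under the memoryless revision rule. -/
noncomputable def valuationAt {i : I} (v : G.Valuation i) (ω : ℕ → G.Terminal) (t : ℕ) :
    G.Valuation i := (G.memoryless i).revise v (history ω t)

theorem valuationAt_succ {i : I} (v : G.Valuation i) (ω : ℕ → G.Terminal) (t : ℕ) :
    valuationAt v ω (t + 1) = G.memorylessStep (valuationAt v ω t) (ω t) := by
  simp [valuationAt, memoryless, history_succ]

theorem valuationAt_succ_of_onPath {i : I} (v : G.Valuation i) {ω : ℕ → G.Terminal} {t : ℕ}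
    {m : G.PlayerMove i} (h : G.OnPath m.1 (ω t)) :
    valuationAt v ω (t + 1) m = G.payoff i (ω t) := by
  rw [valuationAt_succ, memorylessStep, if_pos h]

theorem valuationAt_succ_of_not_onPath {i : I} (v : G.Valuation i) {ω : ℕ → G.Terminal} {t : ℕ}
    {m : G.PlayerMove i} (h : ¬ G.OnPath m.1 (ω t)) :
    valuationAt v ω (t + 1) m = valuationAt v ω t m := by
  rw [valuationAt_succ, memorylessStep, if_neg h]

/-- Revisions only write the payoffs 0 and 1. Nonnegativity is what turns a maximum of 0 into a tie
of all moves. -/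
theorem valuationAt_nonneg {i : I} (hwl : G.IsWinLose i) {v : G.Valuation i} (hv : ∀ m, 0 ≤ v m)
    (ω : ℕ → G.Terminal) (t : ℕ) (m : G.PlayerMove i) : 0 ≤ valuationAt v ω t m := by
  induction t with
  | zero => exact hv m
  | succ t ih =>
    by_cases h : G.OnPath m.1 (ω t)
    · rw [valuationAt_succ_of_onPath v h]
      rcases hwl (ω t) with h | h <;> simp [h]
    · rwa [valuationAt_succ_of_not_onPath v h]

/-- A move that is followed infinitely often, and from some time on only to a win, has value `1`
from some time on. -/
theorem eventually_valuationAt_eq_one {i : I} (v : G.Valuation i) {ω : ℕ → G.Terminal}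
    {m : G.PlayerMove i} (hf : ∃ᶠ t in atTop, G.OnPath m.1 (ω t))
    (hw : ∀ᶠ t in atTop, G.OnPath m.1 (ω t) → G.payoff i (ω t) = 1) :
    ∀ᶠ t in atTop, valuationAt v ω t m = 1 := by
  obtain ⟨T, hT⟩ := eventually_atTop.1 hw
  obtain ⟨t₀, ht₀, hm⟩ := frequently_atTop.1 hf T
  refine eventually_atTop.2 ⟨t₀ + 1, fun t ht => ?_⟩
  induction t, ht using Nat.le_induction with
  | base => rw [valuationAt_succ_of_onPath v hm, hT _ ht₀ hm]
  | succ t ht ih =>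
    by_cases h : G.OnPath m.1 (ω t)
    · rw [valuationAt_succ_of_onPath v h, hT t (by omega) h]
    · rw [valuationAt_succ_of_not_onPath v h, ih]

/-- A move that leads to a loss infinitely often is followed infinitely often while its value
is `0`. -/
theorem frequently_onPath_and_valuationAt_eq_zero {i : I} (v : G.Valuation i)
    {ω : ℕ → G.Terminal} {m : G.PlayerMove i}
    (hf : ∃ᶠ t in atTop, G.OnPath m.1 (ω t) ∧ G.payoff i (ω t) = 0) :
    ∃ᶠ t in atTop, G.OnPath m.1 (ω t) ∧ valuationAt v ω t m = 0 := by
  classical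
  refine frequently_atTop.2 fun T => ?_
  obtain ⟨t₁, ht₁, hm, hl⟩ := frequently_atTop.1 hf T
  have hex : ∃ k, G.OnPath m.1 (ω (t₁ + 1 + k)) := by
    obtain ⟨t, ht, h, -⟩ := frequently_atTop.1 hf (t₁ + 1)
    exact ⟨t - (t₁ + 1), by rwa [Nat.add_sub_cancel' ht]⟩
  -- The loss in round `t₁` sets the value to 0, and nothing revises it before the next visit.
  have hv : ∀ k ≤ Nat.find hex, valuationAt v ω (t₁ + 1 + k) m = 0 := by
    intro k hk
    induction k with
    | zero => rw [Nat.add_zero, valuationAt_succ_of_onPath v hm, hl]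
    | succ k ih =>
      rw [← Nat.add_assoc, valuationAt_succ_of_not_onPath v (Nat.find_min hex hk), ih (by omega)]
  exact ⟨t₁ + 1 + Nat.find hex, by omega, Nat.find_spec hex, hv _ le_rfl⟩

/-! ### Backward induction over the winning nodes. -/

variable [Finite V]

/-- Player `i` wins surely from the node `n` if the profile `σ` is played. -/
def WinsFrom (i : I) (σ : G.Profile) (n : V) : Prop :=
  ∀ z, G.playFrom σ n z ≠ 0 → G.payoff i z = 1

theorem WinsFrom.of_arc {i : I} {σ : G.Profile} {n : V} (h : WinsFrom i σ n)
    (hn : ∃ m, G.Arc n m) {m : G.Move n} (hm : σ (G.turn n) ⟨n, hn, rfl⟩ m ≠ 0) :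
    WinsFrom i σ m.1 := fun z hz => h z <| by
  rw [playFrom_of_arc σ hn]
  exact (PMF.mem_support_bind_iff _ _ _).2 ⟨m, hm, hz⟩

/-- If the moves of `i` maximize the valuation, and every move of `i` that infinitely often
maximizes the valuation at a node that is reached is made infinitely often, then `i` loses only
finitely often after nodes from which a profile `σ` with full support for the other players wins. -/
theorem eventually_win_of_winsFrom {i : I} (hwl : G.IsWinLose i) {v : G.Valuation i}
    (hv : ∀ m, 0 ≤ v m) {ω : ℕ → G.Terminal}
    (hmax : ∀ (n : G.DecisionNode i) (m : G.Move n.1),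
      ∀ᶠ t in atTop, G.OnPath m.1 (ω t) → m ∈ G.maximizers (valuationAt v ω t) n)
    (hrec : ∀ (n : G.DecisionNode i) (m : G.Move n.1),
      (∃ᶠ t in atTop, m ∈ G.maximizers (valuationAt v ω t) n ∧ G.OnPath n.1 (ω t)) →
        ∃ᶠ t in atTop, G.OnPath m.1 (ω t))
    {σ : G.Profile} (hσ : ∀ j ≠ i, ∀ n m, σ j n m ≠ 0) (n : V) (hn : WinsFrom i σ n) :
    ∀ᶠ t in atTop, G.OnPath n (ω t) → G.payoff i (ω t) = 1 := by
  induction n using G.wellFounded_flip_arc.induction with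
  | _ n ih =>
    by_cases hex : ∃ m, G.Arc n m
    · suffices H : ∀ m : G.Move n, ∀ᶠ t in atTop, G.OnPath m.1 (ω t) → G.payoff i (ω t) = 1 by
        filter_upwards [eventually_all.2 H] with t ht h
        rcases h.cases_head with h | ⟨m, hm, h⟩
        · obtain ⟨m, hm⟩ := hex
          exact ((ω t).2 m (h ▸ hm)).elim
        · exact ht ⟨m, hm⟩ h
      intro m
      by_cases hi : G.turn n = i
      · obtain ⟨m', hm'⟩ := (σ (G.turn n) ⟨n, hex, rfl⟩).support_nonempty
        have hw' := ih m'.1 m'.2 (hn.of_arc hex hm')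
        let d : G.DecisionNode i := ⟨n, hex, hi⟩
        by_contra hloss
        have hloss' : ∃ᶠ t in atTop, G.OnPath m.1 (ω t) ∧ G.payoff i (ω t) = 0 := by
          refine (not_eventually.1 hloss).mono fun t ht => ?_
          obtain ⟨h₁, h₂⟩ := Classical.not_imp.1 ht
          exact ⟨h₁, (hwl (ω t)).resolve_right h₂⟩
        have hzero := (frequently_onPath_and_valuationAt_eq_zero v
          (m := G.toPlayerMove d m) hloss').and_eventually (hmax d m)
        have hle : ∃ᶠ t in atTop, G.OnPath n (ω t) ∧
            ∀ c : G.Move n, valuationAt v ω t (G.toPlayerMove d c) ≤ 0 :=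
          hzero.mono fun t ht => ⟨Relation.ReflTransGen.head m.2 ht.1.1,
            fun c => (ht.2 ht.1.1 c).trans_eq ht.1.2⟩
        -- All values at `n` are at most 0 and none is negative, so `m'` is a maximizer as well.
        have hf := hrec d m' <| hle.mono fun t ht =>
          ⟨fun c => (ht.2 c).trans (valuationAt_nonneg hwl hv ω t _), ht.1⟩
        obtain ⟨t, ht, h1⟩ := (hle.and_eventually
          (eventually_valuationAt_eq_one v (m := G.toPlayerMove d m') hf hw')).exists
        exact absurd (h1 ▸ ht.2 m') (by norm_num)
      -- Full support of the opponents makes every successor winning.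
      · exact ih m.1 m.2 (hn.of_arc hex (hσ _ hi ⟨n, hex, rfl⟩ m))
    · have hz := hn ⟨n, not_exists.1 hex⟩ <| by
        rw [playFrom_of_terminal σ (not_exists.1 hex)]
        exact (PMF.mem_support_pure_iff _ _).2 rfl
      refine Eventually.of_forall fun t ht => ?_
      rcases ht.cases_head with h | ⟨m, hm, -⟩
      · rwa [show ω t = ⟨n, not_exists.1 hex⟩ from Subtype.ext h.symm]
      · exact (hex ⟨m, hm⟩).elim

/-- Uniform play of the opponents gives every reply positive probability, so a sure win against this
one profile captures a win against all. -/
theorem exists_winsFrom_root {i : I} (hwin : G.CanGuaranteeWin i) :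
    ∃ σ : G.Profile, (∀ j ≠ i, ∀ n m, σ j n m ≠ 0) ∧ WinsFrom i σ G.root := by
  classical
  obtain ⟨s, hs⟩ := hwin
  have hne : ∀ {j} (n : G.DecisionNode j),
      (Set.toFinite (Set.univ : Set (G.Move n.1))).toFinset.Nonempty :=
    fun n => (Set.toFinite _).toFinset_nonempty.2 (n.2.1.elim fun m hm => ⟨⟨m, hm⟩, trivial⟩)
  let u : G.Profile := fun j n => PMF.uniformOfFinset _ (hne n)
  refine ⟨Function.update u i s, fun j hj n m => ?_, hs _ (Function.update_self ..)⟩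
  rw [Function.update_of_ne hj, ← PMF.mem_support_iff, PMF.mem_support_uniformOfFinset_iff]
  simp

/-! ### Almost sure properties of the random history. -/

theorem ae_nextRound_ne_zero (S : G.SuperProfile) :
    ∀ᵐ ω ∂G.historyMeasure S, ∀ t, G.nextRound S (history ω (t + 1)) (ω (t + 1)) ≠ 0 := by
  refine ae_all_iff.2 fun t => ?_
  have h := Kernel.map_frestrictLe_trajMeasure_compProd_eq_map_trajMeasure (X := fun _ => G.Terminal)
    (μ₀ := (G.nextRound S []).toMeasure) (κ := G.roundKernel S) (a := t)
  have h' : ∀ᵐ p ∂((G.historyMeasure S).map (Preorder.frestrictLe t) ⊗ₘ G.roundKernel S t),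
      G.nextRound S (List.ofFn fun k : Fin (t + 1) =>
        p.1 ⟨k.1, Finset.mem_Iic.2 (Nat.le_of_lt_succ k.2)⟩) p.2 ≠ 0 := by
    refine Measure.ae_compProd_of_ae_ae .of_discrete (Eventually.of_forall fun x => ?_)
    rw [ae_iff]
    refine (PMF.toMeasure_apply_eq_zero_iff _ .of_discrete).2 (Set.disjoint_left.2 ?_)
    exact fun z hz hz' => hz' hz
  rw [historyMeasure, h] at h'
  exact ae_of_ae_map (f := fun ω : ℕ → G.Terminal =>
    (Preorder.frestrictLe (π := fun _ => G.Terminal) t ω, ω (t + 1))) (by fun_prop) h'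

/-- After a history that makes `m` a maximizer, following `m` is at least `1 / Nat.card (G.Move
n.1)` times as likely as reaching `n`; this ratio is the hypothesis of the Borel-Cantelli lemma. -/
theorem ae_frequently_onPath_move {i : I} (v : G.Valuation i) (S : G.SuperProfile)
    (hS : S i = G.valuationSuperStrategy (G.myopic i) (G.memoryless i) v)
    (n : G.DecisionNode i) (m : G.Move n.1) :
    ∀ᵐ ω ∂G.historyMeasure S,
      (∃ᶠ t in atTop, m ∈ G.maximizers (valuationAt v ω t) n ∧ G.OnPath n.1 (ω t)) →
        ∃ᶠ t in atTop, G.OnPath m.1 (ω t) := by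
  have : Nonempty (G.Move n.1) := ⟨m⟩
  have hcard : 0 < Nat.card (G.Move n.1) := Nat.card_pos
  have key := Kernel.ae_frequently_of_kernel_le (G.nextRound S []).toMeasure (G.roundKernel S)
    (fun t => {x | m ∈ G.maximizers ((G.memoryless i).revise v (List.ofFn fun k : Fin (t + 1) =>
      x ⟨k.1, Finset.mem_Iic.2 (Nat.le_of_lt_succ k.2)⟩)) n})
    {z | G.OnPath n.1 z} {z | G.OnPath m.1 z} (Nat.card (G.Move n.1)) (by exact_mod_cast hcard) ?_
  · filter_upwards [key] with ω hω h
    refine hω (frequently_atTop.2 fun T => ?_)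
    -- The kernels describe rounds `t + 1` only, so round 0 is skipped.
    obtain ⟨t, ht, h₁⟩ := frequently_atTop.1 h (T + 1)
    obtain ⟨t, rfl⟩ := Nat.exists_eq_add_of_le' (Nat.le_of_add_left_le ht)
    exact ⟨t, by omega, h₁⟩
  · intro t x hx
    set h := List.ofFn fun k : Fin (t + 1) =>
      x ⟨k.1, Finset.mem_Iic.2 (Nat.le_of_lt_succ k.2)⟩ with hh
    change (G.play fun j => S j h).toMeasure _ ≤ _ * (G.play fun j => S j h).toMeasure _
    rw [toMeasure_play_move _ n m, ← mul_assoc]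
    refine le_mul_of_one_le_left zero_le ?_
    rw [hS]
    have hi := inv_card_le_myopic _ n m hx
    calc (1 : ENNReal) = Nat.card (G.Move n.1) * (Nat.card (G.Move n.1) : ENNReal)⁻¹ :=
          (ENNReal.mul_inv_cancel (by exact_mod_cast hcard.ne') (ENNReal.natCast_ne_top _)).symm
      _ ≤ _ := by
          push_cast
          exact mul_le_mul_right hi _

end PerfectInfoGame

theorem theorem1 {I V : Type*} [Finite I] [Finite V] (G : PerfectInfoGame I V) (i : I)
    (hwl : G.IsWinLose i) (hwin : G.CanGuaranteeWin i)
    (v : G.Valuation i) (hv : ∀ m, 0 ≤ v m)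
    (S : G.SuperProfile)
    (hS : S i = G.valuationSuperStrategy (G.myopic i) (G.memoryless i) v) :
    ∀ᵐ ω ∂(G.historyMeasure S), ∃ T : ℕ, ∀ t ≥ T, G.payoff i (ω t) = 1 := by
  obtain ⟨σ, hσ, hroot⟩ := PerfectInfoGame.exists_winsFrom_root hwin
  filter_upwards [PerfectInfoGame.ae_nextRound_ne_zero S,
    ae_all_iff.2 fun n => ae_all_iff.2 fun m =>
      PerfectInfoGame.ae_frequently_onPath_move v S hS n m] with ω hsupp hrec
  have hmax : ∀ (n : G.DecisionNode i) (m : G.Move n.1), ∀ᶠ t in atTop,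
      G.OnPath m.1 (ω t) → m ∈ G.maximizers (PerfectInfoGame.valuationAt v ω t) n := by
    -- `hsupp` covers the rounds from 1 on, which suffices for an eventual statement.
    refine fun n m => eventually_atTop.2 ⟨1, fun t ht hm => ?_⟩
    obtain ⟨t, rfl⟩ := Nat.exists_eq_add_of_le' ht
    have h := PerfectInfoGame.apply_ne_zero_of_play_ne_zero _ n m (hsupp t) hm
    rw [hS] at h
    exact (PerfectInfoGame.mem_support_myopic_iff _ n m).1 h
  obtain ⟨T, hT⟩ := eventually_atTop.1
    (PerfectInfoGame.eventually_win_of_winsFrom hwl hv hmax hrec hσ G.root hroot)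
  exact ⟨T, fun t ht => hT t ht (G.reachable _)⟩
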